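/- Let $q\ge 0$ be a real number, and write $[a]=\sum_{k=0}^{a-1}q^k$, $[n]!=\prod_{i=1}^n[i]$ and $\binom{n}{k}_q=\frac{[n]!}{[k]!\,[n-k]!}$ for $0\le k\le n$. A configuration with $n$ balls is a tuple $c=(c_1,\dots,c_n)$ of non-negative integers with $\sum_i c_i=n$; let $\mathrm{MSet}(c)$ be the multiset containing each $i\in\{1,\dots,n\}$ exactly $c_i$ times. Drop the $n$ balls one at a time, in a chosen order $u_1,\dots,u_n$ of the elements of $\mathrm{MSet}(c)$, onto the initially empty line $\mathbb{Z}$, the $i$-th ball at site $u_i$: as long as the current ball is at an occupied site it moves, independently at each step, one site to the left with probability $\frac{q}{1+q}$ and one site to the right with probability $\frac{1}{1+q}$; it stops at the first empty site it reaches, which then becomes occupied, and the next ball is dropped. Let $A_c=A_c(q)=[n]!\cdot\mathbb{P}(c\to\{1,\dots,n\})$, where $\mathbb{P}(c\to\{1,\dots,n\})$ is the probability that the set of finally occupied sites is $\{1,\dots,n\}$ (this probability does not depend on the chosen order). The configuration $c$ is called almost Łukasiewicz if exactly one of its heights $H_{c,k}=\sum_{i=1}^k(c_i-1)$, $1\le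 k\le n$, is negative (this height is then equal to $-1$); the index $j$ of the negative height is called the defect of $c$. **Theorem.** Let $c$ be an almost Łukasiewicz configuration with $n$ balls and defect $j$. Then, for every order in which the balls are dropped, $$A_c=\prod_{a\in \mathrm{MSet}(c)}[a]\;-\;\binom{n+1}{j}_q\prod_{a\in \mathrm{MSet}(c),\,a<j}[a]\prod_{b\in \mathrm{MSet}(c),\,b>j}[b-j].$$ -/

import Mathlib

open scoped NNReal ENNReal

noncomputable section

namespace RemixedEulerian

/-! ### `q`-analogues -/

/-- The `q`-integer `[a] = 1 + q + ⋯ + q^(a-1)`. -/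
def qInt (q : ℝ) (a : ℕ) : ℝ := ∑ k ∈ Finset.range a, q ^ k

/-- The `q`-factorial `[n]! = [1][2]⋯[n]`. -/
def qFactorial (q : ℝ) (n : ℕ) : ℝ := ∏ i ∈ Finset.Icc 1 n, qInt q i

/-- The `q`-binomial coefficient `[n]! / ([k]! [n-k]!)`, for `k ≤ n`. -/
def qBinom (q : ℝ) (n k : ℕ) : ℝ :=
  qFactorial q n / (qFactorial q k * qFactorial q (n - k))

/-! ### Configurations -/

/-- A configuration of `n` balls on the sites `1, …, n`: a tuple `(c_1, …, c_n)` of natural numbers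
with sum `n`, encoded as a function on `ℕ` that vanishes outside `{1, …, n}`. -/
structure Configuration (n : ℕ) where
  /-- The number `c_i` of balls at site `i`. -/
  balls : ℕ → ℕ
  balls_eq_zero : ∀ i, i ∉ Finset.Icc 1 n → balls i = 0
  sum_balls : ∑ i ∈ Finset.Icc 1 n, balls i = n

namespace Configuration

variable {n : ℕ}

/-- The multiset of balls of `c`, which contains every site `i ∈ {1, …, n}` exactly `c_i` times. -/
def MSet (c : Configuration n) : Multiset ℕ :=
  ∑ i ∈ Finset.Icc 1 n, Multiset.replicate (c.balls i) i

/-- The height of `c` at index `k`: the sum of `c_i - 1` over `1 ≤ i ≤ k`. -/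
def height (c : Configuration n) (k : ℕ) : ℤ :=
  ∑ i ∈ Finset.Icc 1 k, ((c.balls i : ℤ) - 1)

/-- A configuration is almost Łukasiewicz if exactly one of its heights at the indices
`1, …, n` is negative. -/
def IsAlmostLukasiewicz (c : Configuration n) : Prop :=
  ∃! j, j ∈ Finset.Icc 1 n ∧ c.height j < 0

/-- `j` is an index at which the height is negative. An almost Łukasiewicz configuration has exactly
one such index, its defect. -/
def IsDefect (c : Configuration n) (j : ℕ) : Prop :=
  j ∈ Finset.Icc 1 n ∧ c.height j < 0

/-- The sequence `u` is an order in which the balls of `c` can be dropped (`u` has content `c`). -/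
def IsDropOrder (c : Configuration n) (u : List ℕ) : Prop :=
  (u : Multiset ℕ) = c.MSet

end Configuration

/-! ### The particle model -/

/-- A biased coin: `true` (move left) has probability `q / (1 + q)` and `false` (move right)
has probability `1 / (1 + q)`. -/
def coin (q : ℝ≥0) : PMF Bool :=
  PMF.ofFintype (fun b => ((if b then q / (1 + q) else 1 / (1 + q) : ℝ≥0) : ℝ≥0∞)) (by
    have h : q / (1 + q) + 1 / (1 + q) = 1 := by
      rw [← add_div, add_comm q 1, div_self (by positivity)]
    rw [Fintype.sum_bool, ← ENNReal.coe_add]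
    simp only [if_true, Bool.false_eq_true, if_false, h, ENNReal.coe_one])

/-- A state of the dynamic: the finite set of sites of `ℤ` that are occupied by balls which have
already stopped, and the list of positions of the balls that have not stopped yet. The head of
the list is the ball in motion (about to land on the site given), the tail are the balls still to
be dropped, in order. -/
abbrev State : Type := Finset ℤ × List ℤ

/-- One step of the dynamic. If the ball in motion is at an empty site then it stops there (and
the next ball is dropped); otherwise it moves one site left with probability `q / (1 + q)` and one
site right with probability `1 / (1 + q)`. When no ball is left the dynamic has ended. -/
def step (q : ℝ≥0) : State → PMF State
  | (S, []) => PMF.pure (S, [])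
  | (S, x :: us) =>
      if x ∈ S then
        (coin q).bind fun left => PMF.pure (S, (if left then x - 1 else x + 1) :: us)
      else PMF.pure (insert x S, us)

/-- The law of the state at time `t`, for the Markov chain with transitions `step q` started
at the state `s`. -/
def law (q : ℝ≥0) (s : State) : ℕ → PMF State
  | 0 => PMF.pure s
  | t + 1 => (law q s t).bind (step q)

/-- The probability that the dynamic, with balls dropped onto the empty line `ℤ` in the order `u`,
ends with final support `T`. Since `(T, [])` is absorbing, the events "the dynamic has ended
with support `T` by time `t`" increase with `t`, and the probability of their union is the
supremum of their probabilities. -/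
def finalSupportProb (q : ℝ≥0) (u : List ℕ) (T : Finset ℤ) : ℝ≥0∞ :=
  ⨆ t : ℕ, law q (∅, u.map (fun i : ℕ => (i : ℤ))) t (T, [])

/-- The remixed Eulerian number `A_c(q) = [n]! · P(c → [1;n])` of a configuration `c` with `n` balls,
computed with the balls of `c` dropped in the order `u`. -/
def remixedEulerian {n : ℕ} (q : ℝ≥0) (c : Configuration n) (u : List ℕ)
    (_hu : c.IsDropOrder u) : ℝ :=
  qFactorial q n * (finalSupportProb q u (Finset.Icc 1 (n : ℤ))).toReal

end RemixedEulerian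

end

/-! The proof uses product martingales. If `g` is harmonic for the biased walk, the product of `g`
over the positions of all balls, settled or not, keeps its mean: settling moves nothing, and a step
of the moving ball averages a single factor. The dynamic ends almost surely and all balls stay in a
bounded interval, so the initial product equals the mean of the product over the final support
(`sum_finalSupportProb_mul_weight`).

No ball crosses an empty site. Hence, among supports inside the positive sites, only `{1, …, n}` and
`{1, …, n+1} \ {j}` can occur (`HasDefectAt.final_support`); let `P₁` and `P₂` be their
probabilities. The weight `[x]`, zero for `x ≤ 0`, gives `P₁ [n]! + P₂ [n+1]!/[j] = ∏ [a]`. The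
weight that restarts as `[x - j]` at `j` kills the first support and gives `P₂ [j-1]! [n+1-j]! =
∏_{a<j} [a] ∏_{b>j} [b-j]`. Eliminating `P₂` yields the formula. The second weight is not harmonic
at `j - 1`, but a collision there never happens while the product is nonzero
(`HasDefectAt.isHarmonicOn_splitWeight`). -/

noncomputable section

namespace RemixedEulerian

/-! ### Expectations -/

/-- The expectation of a nonnegative function under a discrete law. -/
def expect {α : Type*} (p : PMF α) (f : α → ℝ≥0∞) : ℝ≥0∞ := ∑' a, p a * f a

section expect

variable {α β : Type*}

theorem expect_pure (a : α) (f : α → ℝ≥0∞) : expect (PMF.pure a) f = f a := by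
  classical
  rw [expect, tsum_eq_single a]
  · simp
  · intro b hb
    simp [PMF.pure_apply, hb]

theorem expect_bind (p : PMF α) (k : α → PMF β) (f : β → ℝ≥0∞) :
    expect (p.bind k) f = expect p (fun a => expect (k a) f) := by
  simp only [expect, PMF.bind_apply, ← ENNReal.tsum_mul_right, ← ENNReal.tsum_mul_left]
  rw [ENNReal.tsum_comm]
  simp only [mul_assoc]

theorem expect_mono {p : PMF α} {f g : α → ℝ≥0∞} (h : ∀ a ∈ p.support, f a ≤ g a) :
    expect p f ≤ expect p g := by
  refine ENNReal.tsum_le_tsum fun a => ?_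
  by_cases ha : p a = 0
  · simp [ha]
  · gcongr
    exact h a ((PMF.mem_support_iff _ _).2 ha)

theorem expect_congr {p : PMF α} {f g : α → ℝ≥0∞} (h : ∀ a ∈ p.support, f a = g a) :
    expect p f = expect p g :=
  le_antisymm (expect_mono fun a ha => (h a ha).le) (expect_mono fun a ha => (h a ha).ge)

theorem expect_add (p : PMF α) (f g : α → ℝ≥0∞) :
    expect p (fun a => f a + g a) = expect p f + expect p g := by
  simp only [expect, mul_add, ENNReal.tsum_add]

theorem expect_const (p : PMF α) (b : ℝ≥0∞) : expect p (fun _ => b) = b := by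
  rw [expect, ENNReal.tsum_mul_right, p.tsum_coe, one_mul]

theorem expect_const_mul (p : PMF α) (b : ℝ≥0∞) (f : α → ℝ≥0∞) :
    expect p (fun a => b * f a) = b * expect p f := by
  simp only [expect, ← ENNReal.tsum_mul_left]
  exact tsum_congr fun a => by ring

theorem expect_finset_sum {ι : Type*} (p : PMF α) (s : Finset ι) (f : ι → α → ℝ≥0∞) :
    expect p (fun a => ∑ i ∈ s, f i a) = ∑ i ∈ s, expect p (f i) := by
  classical
  induction s using Finset.induction_on with
  | empty => simp [expect]
  | insert i s hi ih => simp only [Finset.sum_insert hi, expect_add, ih]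

theorem expect_ite_eq [DecidableEq α] (p : PMF α) (a : α) (b : ℝ≥0∞) :
    expect p (fun x => if x = a then b else 0) = p a * b := by
  rw [expect, tsum_eq_single a]
  · simp
  · intro x hx
    simp [hx]

end expect

/-! ### One step of the dynamic -/

theorem expect_step_nil (q : ℝ≥0) (S : Finset ℤ) (f : State → ℝ≥0∞) :
    expect (step q (S, [])) f = f (S, []) := by
  rw [step, expect_pure]

theorem expect_step_of_notMem (q : ℝ≥0) {S : Finset ℤ} {x : ℤ} (us : List ℤ) (hx : x ∉ S)
    (f : State → ℝ≥0∞) : expect (step q (S, x :: us)) f = f (insert x S, us) := by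
  rw [step, if_neg hx, expect_pure]

theorem expect_step_of_mem (q : ℝ≥0) {S : Finset ℤ} {x : ℤ} (us : List ℤ) (hx : x ∈ S)
    (f : State → ℝ≥0∞) :
    expect (step q (S, x :: us)) f =
      ((q / (1 + q) : ℝ≥0) : ℝ≥0∞) * f (S, (x - 1) :: us) +
        ((1 / (1 + q) : ℝ≥0) : ℝ≥0∞) * f (S, (x + 1) :: us) := by
  rw [step, if_pos hx, expect_bind, expect, tsum_fintype, Fintype.sum_bool]
  simp only [expect_pure]
  simp [coin]

theorem mem_support_step {q : ℝ≥0} {S : Finset ℤ} {us : List ℤ} {s' : State}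
    (h : s' ∈ (step q (S, us)).support) :
    (us = [] ∧ s' = (S, [])) ∨
      (∃ x vs, us = x :: vs ∧ x ∉ S ∧ s' = (insert x S, vs)) ∨
        ∃ x vs, us = x :: vs ∧ x ∈ S ∧ (s' = (S, (x - 1) :: vs) ∨ s' = (S, (x + 1) :: vs)) := by
  cases us with
  | nil => simpa [step] using h
  | cons x vs =>
    by_cases hx : x ∈ S
    · rw [step, if_pos hx, PMF.mem_support_bind_iff] at h
      obtain ⟨b, -, hb⟩ := h
      rw [PMF.mem_support_pure_iff] at hb
      cases b <;> simp_all
    · rw [step, if_neg hx, PMF.mem_support_pure_iff] at h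
      simp_all

/-! ### Invariants of the dynamic -/

/-- The multiset of the positions of all balls of a state. -/
def positions (s : State) : Multiset ℤ := s.1.val + (s.2 : Multiset ℤ)

theorem positions_cons (S : Finset ℤ) (x : ℤ) (us : List ℤ) :
    positions (S, x :: us) = x ::ₘ positions (S, us) := by
  simp only [positions, ← Multiset.cons_coe, Multiset.add_cons]

theorem positions_insert {S : Finset ℤ} {x : ℤ} (hx : x ∉ S) (us : List ℤ) :
    positions (insert x S, us) = x ::ₘ positions (S, us) := by
  simp only [positions, Finset.insert_val_of_notMem hx, Multiset.cons_add]

/-- Properties of all states that can be reached from the empty line by dropping the balls `u`: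
the number of balls is preserved; no ball has crossed an empty site; and the
balls have not moved far from the interval `[-m, m]`. -/
structure Reachable (u : Multiset ℤ) (m : ℤ) (s : State) : Prop where
  card_eq : (positions s).card = u.card
  countP_le : ∀ k ∉ s.1, u.countP (· ≤ k) ≤ (positions s).countP (· ≤ k)
  countP_lt : ∀ k ∉ s.1, (positions s).countP (· < k) ≤ u.countP (· < k)
  abs_lt_of_mem : ∀ x ∈ s.1, |x| < m + s.1.card
  abs_le_of_mem : ∀ x ∈ s.2, |x| ≤ m + s.1.card

theorem Reachable.init {u : List ℤ} {m : ℤ} (hu : ∀ x ∈ u, |x| ≤ m) :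
    Reachable u m (∅, u) where
  card_eq := by simp [positions]
  countP_le := by simp [positions]
  countP_lt := by simp [positions]
  abs_lt_of_mem := by simp
  abs_le_of_mem := by simpa using hu

theorem Reachable.step {u : Multiset ℤ} {m : ℤ} {s s' : State} {q : ℝ≥0}
    (h : Reachable u m s) (hs : s' ∈ (step q s).support) : Reachable u m s' := by
  obtain ⟨S, us⟩ := s
  obtain ⟨hcard, hle, hlt, hS, hus⟩ := h
  rcases mem_support_step hs with ⟨rfl, rfl⟩ | ⟨x, vs, rfl, hx, rfl⟩ | ⟨x, vs, rfl, hx, hs'⟩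
  · exact ⟨hcard, hle, hlt, hS, hus⟩
  · have hpos : positions (insert x S, vs) = positions (S, x :: vs) := by
      rw [positions_insert hx, positions_cons]
    have hc : ((insert x S).card : ℤ) = S.card + 1 := by
      rw [Finset.card_insert_of_notMem hx]; push_cast; rfl
    refine ⟨hpos ▸ hcard, fun k hk => ?_, fun k hk => ?_, fun y hy => ?_, fun y hy => ?_⟩
    · rw [hpos]
      exact hle k fun h => hk (Finset.mem_insert_of_mem h)
    · rw [hpos]
      exact hlt k fun h => hk (Finset.mem_insert_of_mem h)
    · simp only at hy ⊢
      rw [hc]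
      rcases Finset.mem_insert.1 hy with rfl | hy
      · have := hus y (by simp)
        simp only at this
        lia
      · have := hS y hy
        simp only at this
        lia
    · simp only at hy ⊢
      rw [hc]
      have := hus y (by simp [hy])
      simp only at this
      lia
  · have key : ∀ y, (y = x - 1 ∨ y = x + 1) → Reachable u m (S, y :: vs) := by
      intro y hy
      simp only [positions_cons] at hcard hle hlt
      refine ⟨?_, fun k hk => ?_, fun k hk => ?_, hS, fun z hz => ?_⟩
      · simpa [positions_cons] using hcard
      -- A ball moves only from an occupied site, so it may arrive at the empty site `k` but cannot
      -- leave it.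
      · have hxk : x ≠ k := fun h => hk (h ▸ hx)
        have := hle k hk
        rw [positions_cons]
        rw [Multiset.countP_cons] at this ⊢
        refine this.trans ?_
        gcongr
        split_ifs <;> lia
      · have hxk : x ≠ k := fun h => hk (h ▸ hx)
        have := hlt k hk
        rw [positions_cons]
        rw [Multiset.countP_cons] at this ⊢
        refine le_trans ?_ this
        gcongr
        split_ifs <;> lia
      · rcases List.mem_cons.1 hz with rfl | hz
        · have := hS x hx
          simp only at this ⊢
          rw [abs_lt] at this
          rw [abs_le]
          lia
        · exact hus z (by simp [hz])
    rcases hs' with rfl | rfl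
    · exact key _ (Or.inl rfl)
    · exact key _ (Or.inr rfl)

theorem Reachable.law {u : Multiset ℤ} {m : ℤ} {s : State} {q : ℝ≥0} (h : Reachable u m s) :
    ∀ (t : ℕ), ∀ s' ∈ (law q s t).support, Reachable u m s'
  | 0, s', hs' => by
    rw [RemixedEulerian.law, PMF.mem_support_pure_iff] at hs'
    exact hs' ▸ h
  | t + 1, s', hs' => by
    rw [RemixedEulerian.law, PMF.mem_support_bind_iff] at hs'
    obtain ⟨a, ha, hs'⟩ := hs'
    exact (Reachable.law h t a ha).step hs'

theorem Reachable.card_le {u : Multiset ℤ} {m : ℤ} {s : State} (h : Reachable u m s) :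
    s.1.card ≤ u.card := by
  rw [← h.card_eq, positions, Multiset.card_add]
  exact Nat.le_add_right _ _

theorem Reachable.abs_le {u : Multiset ℤ} {m : ℤ} {s : State} (h : Reachable u m s) {x : ℤ}
    (hx : x ∈ positions s) : |x| ≤ m + u.card := by
  have := h.card_le
  rcases Multiset.mem_add.1 hx with hx | hx
  · have := h.abs_lt_of_mem x hx
    lia
  · have := h.abs_le_of_mem x hx
    lia

/-! ### Termination -/

/-- The indicator function of the states in which the dynamic has not ended. -/
def running (s : State) : ℝ≥0∞ := if s.2 = [] then 0 else 1

/-- A function of the state which increases in mean until the dynamic ends. -/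
def potential (q K : ℝ≥0) (M : ℤ) (s : State) : ℝ≥0 :=
  K * s.1.card + match s.2 with
    | [] => 0
    | x :: _ => (q + 2) ^ (x + M).toNat

/-- For any base `z` the mean of the power exceeds `z ^ (a + 1)` by `z ^ a * (z - 1) * (z - q) / (1
+ q)`. At `z = q + 2` this gain is `2 * z ^ a`. -/
theorem add_one_le_mean_pow (q : ℝ≥0) {a : ℕ} :
    (q + 2) ^ (a + 1) + 1 ≤
      q / (1 + q) * (q + 2) ^ a + 1 / (1 + q) * (q + 2) ^ (a + 2) := by
  have h1 : (1 : ℝ) ≤ ((q : ℝ) + 2) ^ a := one_le_pow₀ (by linarith [q.coe_nonneg])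
  rw [← NNReal.coe_le_coe]
  push_cast
  have hq := q.coe_nonneg
  have h : (q : ℝ) / (1 + q) * (q + 2) ^ a + 1 / (1 + q) * (q + 2) ^ (a + 2) =
      (q + 2) ^ (a + 1) + 2 * ((q : ℝ) + 2) ^ a := by
    field_simp
    ring
  rw [h]
  linarith

/-- A collision gains through the power term; a settling may lose that term, but `K` is large enough
to repay it with one unit to spare. -/
theorem potential_add_running_le {u : Multiset ℤ} {m : ℤ} {s : State} {q K : ℝ≥0}
    (h : Reachable u m s) (hK : (q + 2) ^ (2 * (m + u.card)).toNat + 1 ≤ K) :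
    potential q K (m + u.card) s + running s ≤
      expect (step q s) fun s' => potential q K (m + u.card) s' := by
  obtain ⟨S, us⟩ := s
  cases us with
  | nil => simp [expect_step_nil, running]
  | cons x us =>
    have hr : running (S, x :: us) = ((1 : ℝ≥0) : ℝ≥0∞) := by simp [running]
    rw [hr]
    by_cases hx : x ∈ S
    · rw [expect_step_of_mem q us hx]
      norm_cast
      simp only [potential]
      have hb := h.abs_lt_of_mem x hx
      have hc := h.card_le
      simp only at hb hc
      rw [abs_lt] at hb
      -- Settled balls satisfy a strict bound, so even after a step to the left the exponent is not
      -- truncated by `toNat`.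
      obtain ⟨a, ha⟩ : ∃ a : ℕ, x + (m + u.card) = a + 1 :=
        ⟨(x + (m + u.card) - 1).toNat, by lia⟩
      have e0 : (x + (m + u.card)).toNat = a + 1 := by lia
      have e1 : (x - 1 + (m + u.card)).toNat = a := by lia
      have e2 : (x + 1 + (m + u.card)).toNat = a + 2 := by lia
      rw [e0, e1, e2]
      have hq : q / (1 + q) + 1 / (1 + q) = 1 := by
        rw [← add_div, add_comm q 1, div_self (by positivity)]
      calc K * S.card + (q + 2) ^ (a + 1) + 1
          = (q / (1 + q) + 1 / (1 + q)) * (K * S.card) + ((q + 2) ^ (a + 1) + 1) := by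
            rw [hq]; ring
        _ ≤ (q / (1 + q) + 1 / (1 + q)) * (K * S.card) +
            (q / (1 + q) * (q + 2) ^ a + 1 / (1 + q) * (q + 2) ^ (a + 2)) := by
            exact add_le_add_right (add_one_le_mean_pow q) _
        _ = _ := by ring
    · rw [expect_step_of_notMem q us hx]
      norm_cast
      have hb := h.abs_le (x := x) (by simp [positions_cons])
      rw [_root_.abs_le] at hb
      simp only [potential, Finset.card_insert_of_notMem hx]
      calc K * S.card + (q + 2) ^ (x + (m + u.card)).toNat + 1
          ≤ K * S.card + ((q + 2) ^ (2 * (m + u.card)).toNat + 1) := by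
            rw [add_assoc]
            gcongr
            · exact le_add_left (by norm_num)
            · lia
        _ ≤ K * S.card + K := by gcongr
        _ = K * (S.card + 1 : ℕ) := by push_cast; ring
        _ ≤ _ := le_self_add

theorem sum_running_le {u : Multiset ℤ} {m : ℤ} {s : State} {q K : ℝ≥0}
    (h : Reachable u m s) (hK : (q + 2) ^ (2 * (m + u.card)).toNat + 1 ≤ K) (t : ℕ) :
    ∑ i ∈ Finset.range t, expect (law q s i) running ≤
      expect (law q s t) fun s' => potential q K (m + u.card) s' := by
  induction t with
  | zero => simp
  | succ t ih =>
    rw [Finset.sum_range_succ, law, expect_bind]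
    refine (add_le_add_left ih _).trans ?_
    rw [← expect_add]
    exact expect_mono fun a ha => potential_add_running_le (h.law t a ha) hK

/-- The potential is bounded on reachable states, so the expected running time is finite and the
terms of the series tend to zero. -/
theorem tendsto_expect_running {u : Multiset ℤ} {m : ℤ} {s : State} {q : ℝ≥0}
    (h : Reachable u m s) :
    Filter.Tendsto (fun t => expect (law q s t) running) Filter.atTop (nhds 0) := by
  set K : ℝ≥0 := (q + 2) ^ (2 * (m + u.card)).toNat + 1 with hK
  refine ENNReal.tendsto_atTop_zero_of_tsum_ne_top
    (ne_top_of_le_ne_top (b := ((K * u.card + K : ℝ≥0) : ℝ≥0∞)) ENNReal.coe_ne_top ?_)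
  rw [ENNReal.tsum_eq_iSup_nat]
  refine iSup_le fun t => (sum_running_le h hK.symm.le t).trans ?_
  rw [← expect_const (law q s t) ((K * u.card + K : ℝ≥0) : ℝ≥0∞)]
  refine expect_mono fun s' hs' => ENNReal.coe_le_coe.2 ?_
  have hr := h.law t s' hs'
  obtain ⟨S, us⟩ := s'
  have hc := hr.card_le
  simp only at hc
  cases us with
  | nil =>
    simp only [potential, add_zero]
    exact le_add_right (by gcongr)
  | cons x us =>
    have hb := hr.abs_le (x := x) (by simp [positions_cons])
    rw [_root_.abs_le] at hb
    simp only [potential]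
    gcongr
    rw [hK]
    refine le_add_right ?_
    gcongr
    · exact le_add_left (by norm_num)
    · lia

/-! ### Product martingales -/

/-- The product of the weights of the positions of all balls. -/
def weight (g : ℤ → ℝ≥0) (s : State) : ℝ≥0 := ((positions s).map g).prod

theorem weight_cons (g : ℤ → ℝ≥0) (S : Finset ℤ) (x : ℤ) (us : List ℤ) :
    weight g (S, x :: us) = g x * weight g (S, us) := by
  simp [weight, positions_cons]

theorem weight_nil (g : ℤ → ℝ≥0) (S : Finset ℤ) : weight g (S, []) = ∏ x ∈ S, g x := by
  simp [weight, positions]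

theorem weight_eq_zero {g : ℤ → ℝ≥0} {s : State} {x : ℤ} (hx : x ∈ positions s) (h : g x = 0) :
    weight g s = 0 :=
  Multiset.prod_eq_zero (Multiset.mem_map.2 ⟨x, hx, h⟩)

/-- `g` is harmonic wherever it is evaluated by the dynamic with a nonzero weight. -/
def IsHarmonicOn (q : ℝ≥0) (u : Multiset ℤ) (m : ℤ) (g : ℤ → ℝ≥0) : Prop :=
  ∀ S x us, Reachable u m (S, x :: us) → x ∈ S → weight g (S, x :: us) ≠ 0 →
    q * g (x - 1) + g (x + 1) = (1 + q) * g x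

theorem expect_step_weight {q : ℝ≥0} {u : Multiset ℤ} {m : ℤ} {g : ℤ → ℝ≥0}
    (hg : IsHarmonicOn q u m g) {s : State} (h : Reachable u m s) :
    expect (step q s) (fun s' => weight g s') = weight g s := by
  obtain ⟨S, us⟩ := s
  cases us with
  | nil => rw [expect_step_nil]
  | cons x us =>
    by_cases hx : x ∈ S
    · rw [expect_step_of_mem q us hx]
      norm_cast
      simp only [weight_cons]
      by_cases hgx : weight g (S, us) = 0
      · simp [hgx]
      -- The ball settled at `x` contributes its own factor `g x`, which survives the step.
      -- Harmonicity is thus not needed where `g` vanishes.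
      · have hgx' : g x ≠ 0 := fun h0 => hgx (weight_eq_zero (by simp [positions, hx]) h0)
        have := hg S x us h hx (by rw [weight_cons]; exact mul_ne_zero hgx' hgx)
        have e : q / (1 + q) * g (x - 1) + 1 / (1 + q) * g (x + 1) = g x := by
          rw [div_mul_eq_mul_div, div_mul_eq_mul_div, ← add_div, one_mul, this,
            mul_div_cancel_left₀ _ (by positivity)]
        rw [← e]
        ring
    · rw [expect_step_of_notMem q us hx, weight, positions_insert hx, ← positions_cons, weight]

theorem expect_law_weight {q : ℝ≥0} {u : Multiset ℤ} {m : ℤ} {g : ℤ → ℝ≥0}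
    (hg : IsHarmonicOn q u m g) {s : State} (h : Reachable u m s) (t : ℕ) :
    expect (law q s t) (fun s' => weight g s') = weight g s := by
  induction t with
  | zero => rw [law, expect_pure]
  | succ t ih =>
    rw [law, expect_bind, ← ih]
    exact expect_congr fun a ha => expect_step_weight hg (h.law t a ha)

/-- All positions lie in a fixed finite interval, and each factor is at most the sum of `g` over it.
-/
theorem exists_weight_le (u : Multiset ℤ) (m : ℤ) (g : ℤ → ℝ≥0) :
    ∃ C : ℝ≥0, ∀ s, Reachable u m s → weight g s ≤ C := by
  refine ⟨(∑ x ∈ Finset.Icc (-(m + u.card)) (m + u.card), g x) ^ u.card, fun s h => ?_⟩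
  have hc : ((positions s).map g).card = u.card := by rw [Multiset.card_map, h.card_eq]
  rw [weight, ← hc]
  refine Multiset.prod_le_pow_card _ _ fun y hy => ?_
  rw [hc]
  obtain ⟨x, hx, rfl⟩ := Multiset.mem_map.1 hy
  have := h.abs_le hx
  rw [_root_.abs_le] at this
  exact Finset.single_le_sum (f := g) (fun _ _ => zero_le) (Finset.mem_Icc.2 this)

/-- Ended states are absorbing. This turns the supremum in `finalSupportProb` into a limit. -/
theorem law_nil_mono (q : ℝ≥0) (s : State) (T : Finset ℤ) :
    Monotone fun t => law q s t (T, []) := by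
  classical
  refine monotone_nat_of_le_succ fun t => ?_
  have e : ∀ t, law q s t (T, []) =
      expect (law q s t) (fun s' => if s' = (T, []) then 1 else 0) := fun t => by
    rw [expect_ite_eq, mul_one]
  rw [e, e, law, expect_bind]
  refine expect_mono fun a _ => ?_
  split_ifs with h
  · rw [h, expect_step_nil, if_pos rfl]
  · exact zero_le

/-- If all possible final supports with nonzero weight belong to `A`, then the
product of the initial weights is the mean of the final weight over `A`. -/
theorem sum_finalSupportProb_mul_weight {q : ℝ≥0} {u : List ℕ} {m : ℤ} {g : ℤ → ℝ≥0}
    (hg : IsHarmonicOn q (u.map fun i : ℕ => (i : ℤ) : List ℤ) m g)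
    (hu : ∀ x ∈ u, (x : ℤ) ≤ m) (A : Finset (Finset ℤ))
    (hA : ∀ T, Reachable (u.map fun i : ℕ => (i : ℤ) : List ℤ) m (T, []) →
      weight g (T, []) ≠ 0 → T ∈ A) :
    ∑ T ∈ A, finalSupportProb q u T * ((∏ x ∈ T, g x : ℝ≥0) : ℝ≥0∞) =
      ((u.map fun i : ℕ => g i).prod : ℝ≥0) := by
  classical
  set v : List ℤ := u.map fun i : ℕ => (i : ℤ) with hv
  have h0 : Reachable v m (∅, v) := Reachable.init fun x hx => by
    obtain ⟨i, hi, rfl⟩ := List.mem_map.1 hx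
    have := hu i hi
    rw [_root_.abs_le]
    lia
  have hw : weight g (∅, v) = (u.map fun i : ℕ => g i).prod := by
    simp [weight, positions, hv, Function.comp_def]
  obtain ⟨C, hC⟩ := exists_weight_le v m g
  -- By `hA`, ended states outside `A` have weight zero, so restricting the sum to `A` loses
  -- nothing.
  have hsplit : ∀ t, expect (law q (∅, v) t) (fun s => running s * weight g s) +
      ∑ T ∈ A, law q (∅, v) t (T, []) * ((∏ x ∈ T, g x : ℝ≥0) : ℝ≥0∞) = weight g (∅, v) := by
    intro t
    rw [← expect_law_weight hg h0 t]
    simp only [← expect_ite_eq]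
    rw [← expect_finset_sum, ← expect_add]
    refine expect_congr fun s hs => ?_
    obtain ⟨S, us⟩ := s
    cases us with
    | nil =>
      simp only [running, if_true, zero_mul, zero_add, Prod.mk.injEq, and_true]
      rw [Finset.sum_ite_eq, weight_nil]
      split_ifs with hS
      · rfl
      · by_contra hne
        refine hS (hA S (h0.law t _ hs) fun h => hne ?_)
        rw [← weight_nil, h]
        rfl
    | cons x us => simp [running]
  have hrun : Filter.Tendsto (fun t => expect (law q (∅, v) t) (fun s => running s * weight g s))
      Filter.atTop (nhds 0) := by
    refine tendsto_of_tendsto_of_tendsto_of_le_of_le tendsto_const_nhds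
      (h := fun t => (C : ℝ≥0∞) * expect (law q (∅, v) t) running) ?_ (fun _ => zero_le) ?_
    · simpa using ENNReal.Tendsto.const_mul (tendsto_expect_running h0)
        (Or.inr (ENNReal.coe_ne_top (r := C)))
    · intro t
      simp only
      rw [← expect_const_mul]
      refine expect_mono fun s hs => ?_
      rw [mul_comm]
      gcongr
      exact hC s (h0.law t s hs)
  have hlim : Filter.Tendsto
      (fun t => ∑ T ∈ A, law q (∅, v) t (T, []) * ((∏ x ∈ T, g x : ℝ≥0) : ℝ≥0∞)) Filter.atTop
      (nhds (∑ T ∈ A, finalSupportProb q u T * ((∏ x ∈ T, g x : ℝ≥0) : ℝ≥0∞))) :=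
    tendsto_finsetSum _ fun T _ => ENNReal.Tendsto.mul_const
      (tendsto_atTop_iSup (law_nil_mono q _ T)) (Or.inr ENNReal.coe_ne_top)
  have := hrun.add hlim
  simp only [hsplit, zero_add] at this
  rw [← hw]
  exact (tendsto_nhds_unique tendsto_const_nhds this).symm

/-! ### Harmonic weights -/

/-- The `q`-integer `[a]` as a nonnegative real number. -/
def qIntNN (q : ℝ≥0) (a : ℕ) : ℝ≥0 := ∑ k ∈ Finset.range a, q ^ k

theorem coe_qIntNN (q : ℝ≥0) (a : ℕ) : (qIntNN q a : ℝ) = qInt q a := by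
  simp [qIntNN, qInt]

theorem qIntNN_zero (q : ℝ≥0) : qIntNN q 0 = 0 := by simp [qIntNN]

theorem qInt_pos (q : ℝ≥0) {a : ℕ} (ha : 1 ≤ a) : 0 < qInt q a := by
  obtain ⟨b, rfl⟩ := Nat.exists_eq_add_of_le' ha
  rw [qInt, Finset.sum_range_succ', pow_zero]
  positivity

/-- The increments of `[x]` are `q ^ x`, each `q` times the previous one. At `x = 1` the value `[0]
= 0` is used. -/
theorem qIntNN_harmonic (q : ℝ≥0) {x : ℤ} (hx : 1 ≤ x) :
    q * qIntNN q (x - 1).toNat + qIntNN q (x + 1).toNat = (1 + q) * qIntNN q x.toNat := by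
  obtain ⟨a, rfl⟩ : ∃ a : ℕ, x = a + 1 := ⟨(x - 1).toNat, by lia⟩
  have e0 : ((a : ℤ) + 1 - 1).toNat = a := by lia
  have e1 : ((a : ℤ) + 1 + 1).toNat = a + 1 + 1 := by lia
  have e2 : ((a : ℤ) + 1).toNat = a + 1 := by lia
  rw [e0, e1, e2]
  simp only [qIntNN, Finset.sum_range_succ]
  ring

/-- The weight `[x]`, which vanishes at the sites `x ≤ 0`. -/
def leftWeight (q : ℝ≥0) (x : ℤ) : ℝ≥0 := qIntNN q x.toNat

/-- The weight which is `[x]` to the left of `j` and `[x - j]` from `j` on. -/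
def splitWeight (q : ℝ≥0) (j x : ℤ) : ℝ≥0 :=
  if x < j then qIntNN q x.toNat else qIntNN q (x - j).toNat

theorem pos_of_leftWeight_ne_zero {q : ℝ≥0} {x : ℤ} (h : leftWeight q x ≠ 0) : 0 < x := by
  by_contra! hx
  exact h (by rw [leftWeight, Int.toNat_of_nonpos hx, qIntNN_zero])

theorem splitWeight_self (q : ℝ≥0) (j : ℤ) : splitWeight q j j = 0 := by
  simp [splitWeight, qIntNN_zero]

theorem pos_of_splitWeight_ne_zero {q : ℝ≥0} {j x : ℤ} (hj : 0 ≤ j)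
    (h : splitWeight q j x ≠ 0) : 0 < x := by
  by_contra! hx
  refine h ?_
  rw [splitWeight]
  split_ifs
  · rw [Int.toNat_of_nonpos hx, qIntNN_zero]
  · rw [Int.toNat_of_nonpos (by lia), qIntNN_zero]

/-! ### Configurations with one defect -/

theorem countP_le_eq_countP_lt_add_count (s : Multiset ℤ) (k : ℤ) :
    s.countP (· ≤ k) = s.countP (· < k) + s.count k := by
  induction s using Multiset.induction_on with
  | empty => simp
  | cons a s ih =>
    rw [Multiset.countP_cons, Multiset.countP_cons, Multiset.count_cons, ih]
    split_ifs <;> lia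

/-- The content `u` consists of `n` balls, at least `k` of them at sites `≤ k` for each `k ≤ n` other
than `j`, all of them at sites `≤ n + 1`, and less than `j` of them at sites `≤ j`. -/
structure HasDefectAt (n j : ℕ) (u : Multiset ℤ) : Prop where
  one_le : 1 ≤ j
  lt : j < n
  card_eq : u.card = n
  le_countP : ∀ k : ℕ, k ≤ n + 1 → k ≠ j → k ≤ u.countP (· ≤ (k : ℤ)) + (k - n)
  countP_lt : u.countP (· ≤ (j : ℤ)) < j

/-- The final supports with nonzero weight. -/
theorem HasDefectAt.final_support {n j : ℕ} {u : Multiset ℤ} (hu : HasDefectAt n j u) {m : ℤ}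
    {T : Finset ℤ} (hT : Reachable u m (T, [])) (hpos : ∀ x ∈ T, 0 < x) :
    T = Finset.Icc 1 (n : ℤ) ∨ T = (Finset.Icc 1 ((n : ℤ) + 1)).erase j := by
  have hj1 := hu.one_le
  have hjn := hu.lt
  have hcard : T.card = n := by
    have := hT.card_eq
    simpa [positions, hu.card_eq] using this
  have hcount : ∀ k : ℤ, (positions (T, [])).countP (· ≤ k) = (T.filter (· ≤ k)).card := by
    intro k
    simp [positions, Multiset.countP_eq_card_filter, Finset.filter_val, Finset.card]
  -- If `k` stayed empty, the balls starting at sites `≤ k`, at least `k` of them, would fill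
  -- distinct sites among the `k - 1` positive ones below `k`.
  have hmem : ∀ k : ℕ, 1 ≤ k → k ≤ n → k ≠ j → (k : ℤ) ∈ T := by
    intro k hk1 hkn hkj
    by_contra hk
    have h1 := hu.le_countP k (by lia) hkj
    have h2 := hT.countP_le k hk
    rw [hcount] at h2
    have h3 : (T.filter (· ≤ (k : ℤ))) ⊆ Finset.Icc 1 ((k : ℤ) - 1) := by
      intro x hx
      rw [Finset.mem_filter] at hx
      have := hpos x hx.1
      have : x ≠ k := fun h => hk (h ▸ hx.1)
      rw [Finset.mem_Icc]
      lia
    have h4 := Finset.card_le_card h3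
    rw [Int.card_Icc] at h4
    lia
  by_cases hj : (j : ℤ) ∈ T
  · left
    symm
    refine Finset.eq_of_subset_of_card_le ?_ (by rw [hcard, Int.card_Icc]; lia)
    intro x hx
    rw [Finset.mem_Icc] at hx
    by_cases hxj : x = j
    · exact hxj ▸ hj
    · have := hmem x.toNat (by lia) (by lia) (by lia)
      rwa [Int.toNat_of_nonneg (by lia)] at this
  · right
    have hc' : ((Finset.Icc 1 ((n : ℤ) + 1)).erase j).card = n := by
      rw [Finset.card_erase_of_mem (Finset.mem_Icc.2 (by lia)), Int.card_Icc]
      lia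
    have hn1 : ((n + 1 : ℕ) : ℤ) ∈ T := by
      by_contra hk
      -- Here the truncated difference equals one, so the bound says that all `n` balls start at
      -- sites `≤ n + 1`; only `n - 1` sites would be left for them.
      have h1 := hu.le_countP (n + 1) le_rfl (by lia)
      have h2 := hT.countP_le _ hk
      rw [hcount] at h2
      have h3 : (T.filter (· ≤ ((n + 1 : ℕ) : ℤ))) ⊆ (Finset.Icc 1 (n : ℤ)).erase j := by
        intro x hx
        rw [Finset.mem_filter] at hx
        have := hpos x hx.1
        have : x ≠ (n + 1 : ℕ) := fun h => hk (h ▸ hx.1)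
        have : x ≠ j := fun h => hj (h ▸ hx.1)
        rw [Finset.mem_erase, Finset.mem_Icc]
        lia
      have h4 := Finset.card_le_card h3
      rw [Finset.card_erase_of_mem (Finset.mem_Icc.2 (by lia)), Int.card_Icc] at h4
      lia
    symm
    refine Finset.eq_of_subset_of_card_le ?_ (by rw [hcard, hc'])
    intro x hx
    rw [Finset.mem_erase, Finset.mem_Icc] at hx
    by_cases hxn : x = (n + 1 : ℕ)
    · exact hxn ▸ hn1
    · have := hmem x.toNat (by lia) (by lia) (by lia)
      rwa [Int.toNat_of_nonneg (by lia)] at this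

theorem isHarmonicOn_leftWeight (q : ℝ≥0) (u : Multiset ℤ) (m : ℤ) :
    IsHarmonicOn q u m (leftWeight q) := by
  intro S x us _ hx hne
  have : 0 < x := pos_of_leftWeight_ne_zero (q := q) fun h =>
    hne (weight_eq_zero (by simp [positions_cons]) h)
  exact qIntNN_harmonic q this

/-- A ball to the left of the defect can only reach it after one of the sites `≤ 0`
or the defect itself has been occupied. -/
theorem HasDefectAt.isHarmonicOn_splitWeight {n j : ℕ} {u : Multiset ℤ} (hu : HasDefectAt n j u)
    (q : ℝ≥0) (m : ℤ) : IsHarmonicOn q u m (splitWeight q j) := by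
  intro S x us hR hx hne
  have hj1 := hu.one_le
  have hjn := hu.lt
  have hpos : ∀ y ∈ positions (S, x :: us), splitWeight q j y ≠ 0 := fun y hy h =>
    hne (weight_eq_zero hy h)
  have hxpos : 0 < x :=
    pos_of_splitWeight_ne_zero (by lia) (hpos x (by simp [positions_cons]))
  have hjS : (j : ℤ) ∉ S := fun h => hpos j (by simp [positions, h]) (splitWeight_self q j)
  have hxj : x ≠ j := fun h => hjS (h ▸ hx)
  have hxj' : x ≠ j - 1 := by
    intro hxe
    -- An occupied site adds a ball to the count below it; across an empty site the count is at
    -- least the initial one.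
    have key : ∀ k : ℕ, k < j → k ≤ (positions (S, x :: us)).countP (· ≤ (k : ℤ)) := by
      intro k
      induction k with
      | zero => simp
      | succ k ih =>
        intro hk
        by_cases hkS : ((k + 1 : ℕ) : ℤ) ∈ S
        · have h1 := ih (by lia)
          have h2 := countP_le_eq_countP_lt_add_count (positions (S, x :: us)) (k + 1 : ℕ)
          have h3 : 1 ≤ (positions (S, x :: us)).count ((k + 1 : ℕ) : ℤ) :=
            Multiset.one_le_count_iff_mem.2 (Multiset.mem_add.2 (Or.inl hkS))
          have h4 : (positions (S, x :: us)).countP (· < ((k + 1 : ℕ) : ℤ)) =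
              (positions (S, x :: us)).countP (· ≤ (k : ℤ)) :=
            Multiset.countP_congr rfl fun y _ => propext (by lia)
          lia
        · have h1 := hu.le_countP (k + 1) (by lia) (by lia)
          have h2 := hR.countP_le _ hkS
          lia
    have h1 := key (j - 2) (by lia)
    have h2 := countP_le_eq_countP_lt_add_count (positions (S, x :: us)) x
    have h3 : 2 ≤ (positions (S, x :: us)).count x := by
      rw [positions_cons, Multiset.count_cons_self]
      have : 1 ≤ (positions (S, us)).count x :=
        Multiset.one_le_count_iff_mem.2 (by simp [positions, hx])
      lia
    have h4 : (positions (S, x :: us)).countP (· < x) =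
        (positions (S, x :: us)).countP (· ≤ ((j - 2 : ℕ) : ℤ)) :=
      Multiset.countP_congr rfl fun y _ => propext (by lia)
    have h5 : (positions (S, x :: us)).countP (· < (j : ℤ)) =
        (positions (S, x :: us)).countP (· ≤ x) :=
      Multiset.countP_congr rfl fun y _ => propext (by lia)
    -- With the `j - 2` balls further left and two at `j - 1`, at least `j` balls are now left of
    -- `j`. Fewer than `j` started there, and none could come across the empty site `j`.
    have h6 := hR.countP_lt j hjS
    have h7 := countP_le_eq_countP_lt_add_count u j
    have h8 := hu.countP_lt
    lia
  rcases lt_or_gt_of_ne hxj with h | h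
  · simp only [splitWeight]
    rw [if_pos (by lia), if_pos (by lia), if_pos (by lia)]
    exact qIntNN_harmonic q hxpos
  · simp only [splitWeight]
    rw [if_neg (by lia), if_neg (by lia), if_neg (by lia)]
    have := qIntNN_harmonic q (x := x - j) (by lia)
    rwa [sub_right_comm, sub_add_eq_add_sub] at this

/-! ### From configurations to contents -/

theorem Configuration.mem_MSet {n : ℕ} (c : Configuration n) {a : ℕ} :
    a ∈ c.MSet ↔ a ∈ Finset.Icc 1 n ∧ c.balls a ≠ 0 := by
  simp only [Configuration.MSet, Multiset.mem_sum, Multiset.mem_replicate]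
  constructor
  · rintro ⟨i, hi, h, rfl⟩
    exact ⟨hi, h⟩
  · rintro ⟨h, h'⟩
    exact ⟨a, h, h', rfl⟩

theorem Configuration.card_MSet {n : ℕ} (c : Configuration n) : c.MSet.card = n := by
  rw [Configuration.MSet, Multiset.card_sum]
  simpa using c.sum_balls

theorem Configuration.countP_MSet {n : ℕ} (c : Configuration n) {k : ℕ} (hk : k ≤ n) :
    (c.MSet.countP (· ≤ k) : ℤ) = k + c.height k := by
  have h : c.MSet.countP (· ≤ k) = ∑ i ∈ Finset.Icc 1 k, c.balls i := by
    rw [Configuration.MSet, ← Multiset.coe_countPAddMonoidHom, map_sum]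
    symm
    refine Finset.sum_subset_zero_on_sdiff (Finset.Icc_subset_Icc_right hk) ?_ ?_
    · intro i hi
      rw [Finset.mem_sdiff, Finset.mem_Icc, Finset.mem_Icc] at hi
      rw [Multiset.coe_countPAddMonoidHom, Multiset.countP_eq_zero]
      intro a ha
      rw [Multiset.eq_of_mem_replicate ha]
      lia
    · intro i hi
      rw [Multiset.coe_countPAddMonoidHom, Multiset.countP_eq_card.2, Multiset.card_replicate]
      intro a ha
      rw [Multiset.eq_of_mem_replicate ha]
      exact (Finset.mem_Icc.1 hi).2
  rw [h, Configuration.height, Finset.sum_sub_distrib]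
  push_cast
  simp

theorem Configuration.height_self {n : ℕ} (c : Configuration n) : c.height n = 0 := by
  rw [Configuration.height, Finset.sum_sub_distrib]
  have := c.sum_balls
  zify at this
  simp [this]

theorem Configuration.IsAlmostLukasiewicz.height_nonneg {n j : ℕ} {c : Configuration n}
    (hc : c.IsAlmostLukasiewicz) (hj : c.IsDefect j) {k : ℕ} (hk : k ≤ n) (hkj : k ≠ j) :
    0 ≤ c.height k := by
  rcases Nat.eq_zero_or_pos k with rfl | hk0
  · simp [Configuration.height]
  · by_contra! h
    exact hkj (hc.unique ⟨Finset.mem_Icc.2 ⟨hk0, hk⟩, h⟩ hj)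

/-- The height falls from nonnegative to negative at `j`. Consequently the initial split weight has
no vanishing factor at `j`. -/
theorem Configuration.IsAlmostLukasiewicz.balls_defect {n j : ℕ} {c : Configuration n}
    (hc : c.IsAlmostLukasiewicz) (hj : c.IsDefect j) : c.balls j = 0 := by
  obtain ⟨hj1, hjn⟩ := Finset.mem_Icc.1 hj.1
  obtain ⟨i, rfl⟩ := Nat.exists_eq_add_of_le' hj1
  have h1 := hc.height_nonneg hj (k := i) (by lia) (by lia)
  have h2 := hj.2
  have h3 : c.height (i + 1) = c.height i + ((c.balls (i + 1) : ℤ) - 1) :=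
    Finset.sum_Icc_succ_top (by lia) _
  lia

theorem Configuration.IsAlmostLukasiewicz.hasDefectAt {n j : ℕ} {c : Configuration n}
    (hc : c.IsAlmostLukasiewicz) (hj : c.IsDefect j) :
    HasDefectAt n j (c.MSet.map fun i : ℕ => (i : ℤ)) := by
  obtain ⟨hj1, hjn⟩ := Finset.mem_Icc.1 hj.1
  have hcount : ∀ k : ℕ, (c.MSet.map fun i : ℕ => (i : ℤ)).countP (· ≤ (k : ℤ)) =
      c.MSet.countP (· ≤ k) := by
    intro k
    rw [Multiset.countP_map, Multiset.countP_eq_card_filter]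
    simp only [Nat.cast_le]
  have hlt : j < n := by
    refine lt_of_le_of_ne hjn fun h => ?_
    have := hj.2
    rw [h, c.height_self] at this
    lia
  refine ⟨hj1, hlt, by rw [Multiset.card_map, c.card_MSet], fun k hk hkj => ?_, ?_⟩
  · rw [hcount]
    rcases Nat.lt_or_ge n k with h | h
    · have : c.MSet.countP (· ≤ k) = n := by
        rw [Multiset.countP_eq_card.2, c.card_MSet]
        intro a ha
        have := Finset.mem_Icc.1 (c.mem_MSet.1 ha).1
        lia
      lia
    · have h1 := c.countP_MSet h
      have h2 := hc.height_nonneg hj h hkj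
      lia
  · rw [hcount]
    have h1 := c.countP_MSet hjn
    have h2 := hj.2
    lia

/-! ### The products over the final supports -/

theorem prod_Icc_int {M : Type*} [CommMonoid M] (f : ℤ → M) (n : ℕ) :
    ∏ x ∈ Finset.Icc 1 (n : ℤ), f x = ∏ i ∈ Finset.Icc 1 n, f i := by
  symm
  refine Finset.prod_nbij (fun i : ℕ => (i : ℤ)) ?_ ?_ ?_ ?_
  · intro i hi
    simp only [Finset.mem_Icc] at hi ⊢
    lia
  · intro a _ b _ h
    simpa using h
  · intro x hx
    simp only [Finset.coe_Icc, Set.mem_Icc] at hx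
    exact ⟨x.toNat, by simp; lia, by simp; lia⟩
  · simp

theorem prod_leftWeight (q : ℝ≥0) (n : ℕ) :
    ((∏ x ∈ Finset.Icc 1 (n : ℤ), leftWeight q x : ℝ≥0) : ℝ) = qFactorial q n := by
  rw [prod_Icc_int, qFactorial]
  push_cast
  refine Finset.prod_congr rfl fun i _ => ?_
  rw [leftWeight, coe_qIntNN, Int.toNat_natCast]

theorem qInt_mul_prod_leftWeight (q : ℝ≥0) {n j : ℕ} (hj1 : 1 ≤ j) (hjn : j ≤ n + 1) :
    qInt q j * ((∏ x ∈ (Finset.Icc 1 ((n : ℤ) + 1)).erase j, leftWeight q x : ℝ≥0) : ℝ) =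
      qFactorial q (n + 1) := by
  have h : (j : ℤ) ∈ Finset.Icc 1 ((n : ℤ) + 1) := Finset.mem_Icc.2 (by lia)
  have := prod_leftWeight q (n + 1)
  push_cast at this ⊢
  rw [← this, ← Finset.mul_prod_erase _ _ h, leftWeight, coe_qIntNN, Int.toNat_natCast]

theorem prod_splitWeight (q : ℝ≥0) {n j : ℕ} (hj1 : 1 ≤ j) (hjn : j ≤ n + 1) :
    ((∏ x ∈ (Finset.Icc 1 ((n : ℤ) + 1)).erase j, splitWeight q j x : ℝ≥0) : ℝ) =
      qFactorial q (j - 1) * qFactorial q (n + 1 - j) := by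
  -- The sites beyond `j` are a translate by `j`, on which the split weight is again `[1], [2], …`.
  have hu : (Finset.Icc 1 ((n : ℤ) + 1)).erase j =
      Finset.Icc 1 ((j - 1 : ℕ) : ℤ) ∪
        (Finset.Icc 1 ((n + 1 - j : ℕ) : ℤ)).map (addLeftEmbedding (j : ℤ)) := by
    rw [Finset.map_add_left_Icc]
    ext x
    simp only [Finset.mem_erase, Finset.mem_Icc, Finset.mem_union]
    lia
  have hd : Disjoint (Finset.Icc 1 ((j - 1 : ℕ) : ℤ))
      ((Finset.Icc 1 ((n + 1 - j : ℕ) : ℤ)).map (addLeftEmbedding (j : ℤ))) := by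
    rw [Finset.map_add_left_Icc, Finset.disjoint_left]
    intro x
    simp only [Finset.mem_Icc]
    lia
  rw [hu, Finset.prod_union hd, Finset.prod_map, ← prod_leftWeight, ← prod_leftWeight,
    ← NNReal.coe_mul]
  congr 2
  · refine Finset.prod_congr rfl fun x hx => ?_
    rw [Finset.mem_Icc] at hx
    rw [splitWeight, if_pos (by lia), leftWeight]
  · refine Finset.prod_congr rfl fun x hx => ?_
    rw [Finset.mem_Icc] at hx
    simp only [addLeftEmbedding_apply]
    rw [splitWeight, if_neg (by lia), leftWeight, add_sub_cancel_left]

theorem prod_splitWeight_eq_zero (q : ℝ≥0) {n j : ℕ} (hj1 : 1 ≤ j) (hjn : j ≤ n) :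
    ∏ x ∈ Finset.Icc 1 (n : ℤ), splitWeight q j x = 0 :=
  Finset.prod_eq_zero (i := (j : ℤ)) (Finset.mem_Icc.2 (by lia)) (splitWeight_self q j)

theorem coe_prod_leftWeight (q : ℝ≥0) (s : Multiset ℕ) :
    ((s.map fun a : ℕ => leftWeight q a).prod : ℝ) = (s.map fun a => qInt q a).prod := by
  induction s using Multiset.induction_on with
  | empty => simp
  | cons a s ih =>
    rw [Multiset.map_cons, Multiset.prod_cons, NNReal.coe_mul, ih, leftWeight, coe_qIntNN,
      Int.toNat_natCast, Multiset.map_cons, Multiset.prod_cons]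

theorem coe_prod_splitWeight (q : ℝ≥0) {j : ℕ} {s : Multiset ℕ} (hj : j ∉ s) :
    ((s.map fun a : ℕ => splitWeight q j a).prod : ℝ) =
      ((s.filter fun a => a < j).map fun a => qInt q a).prod *
        ((s.filter fun b => j < b).map fun b => qInt q (b - j)).prod := by
  induction s using Multiset.induction_on with
  | empty => simp
  | cons a s ih =>
    rw [Multiset.mem_cons, not_or] at hj
    rw [Multiset.map_cons, Multiset.prod_cons, NNReal.coe_mul, ih hj.2, splitWeight]
    rcases lt_or_gt_of_ne hj.1 with h | h
    · rw [if_neg (by lia), Multiset.filter_cons_of_neg (p := fun a => a < j) _ (by lia),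
        Multiset.filter_cons_of_pos (p := fun b => j < b) _ h, Multiset.map_cons,
        Multiset.prod_cons, coe_qIntNN]
      have : ((a : ℤ) - j).toNat = a - j := by lia
      rw [this]
      ring
    · rw [if_pos (by lia), Multiset.filter_cons_of_pos (p := fun a => a < j) _ h,
        Multiset.filter_cons_of_neg (p := fun b => j < b) _ (by lia), Multiset.map_cons,
        Multiset.prod_cons, coe_qIntNN, Int.toNat_natCast]
      ring

theorem finalSupportProb_le_one (q : ℝ≥0) (u : List ℕ) (T : Finset ℤ) :
    finalSupportProb q u T ≤ 1 :=
  iSup_le fun _ => PMF.coe_le_one _ _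

end RemixedEulerian

end

/-! ### Elimination of the second support's probability -/

open RemixedEulerian in
theorem mainTheorem3 (q : NNReal) (n j : ℕ) (c : RemixedEulerian.Configuration n)
    (hc : c.IsAlmostLukasiewicz) (hj : c.IsDefect j)
    (u : List ℕ) (hu : c.IsDropOrder u) :
    RemixedEulerian.remixedEulerian q c u hu =
      (c.MSet.map (fun a => RemixedEulerian.qInt q a)).prod -
        RemixedEulerian.qBinom q (n + 1) j *
          ((c.MSet.filter (fun a => a < j)).map (fun a => RemixedEulerian.qInt q a)).prod *
          ((c.MSet.filter (fun b => j < b)).map (fun b => RemixedEulerian.qInt q (b - j))).prod := by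
  have hD := hc.hasDefectAt hj
  have hj1 := hD.one_le
  have hjn := hD.lt
  have huc : (u : Multiset ℕ) = c.MSet := hu
  have hv : ((u.map fun i : ℕ => (i : ℤ) : List ℤ) : Multiset ℤ) =
      c.MSet.map fun i : ℕ => (i : ℤ) := by
    rw [← huc, Multiset.map_coe]
  have hum : ∀ x ∈ u, (x : ℤ) ≤ n := by
    intro x hx
    have : x ∈ c.MSet := huc ▸ Multiset.mem_coe.2 hx
    exact_mod_cast (Finset.mem_Icc.1 (c.mem_MSet.1 this).1).2
  have hjM : j ∉ c.MSet := fun h => (c.mem_MSet.1 h).2 (hc.balls_defect hj)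
  have hprod : ∀ g : ℤ → NNReal,
      (u.map fun i : ℕ => g i).prod = (c.MSet.map fun i : ℕ => g i).prod := by
    intro g
    rw [← huc, Multiset.map_coe, Multiset.prod_coe]
  set T₁ : Finset ℤ := Finset.Icc 1 (n : ℤ) with hT₁
  set T₂ : Finset ℤ := (Finset.Icc 1 ((n : ℤ) + 1)).erase j with hT₂
  have hne : T₁ ≠ T₂ := fun h =>
    Finset.notMem_erase (j : ℤ) _ (h ▸ Finset.mem_Icc.2 (by lia) : (j : ℤ) ∈ T₂)
  have hmem : ∀ (g : ℤ → NNReal), (∀ x, g x ≠ 0 → 0 < x) → ∀ T,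
      Reachable (u.map fun i : ℕ => (i : ℤ) : List ℤ) n (T, []) →
      weight g (T, []) ≠ 0 → T ∈ ({T₁, T₂} : Finset (Finset ℤ)) := by
    intro g hg T hT hw
    rw [hv] at hT
    rw [Finset.mem_insert, Finset.mem_singleton]
    exact hD.final_support hT fun x hx => hg x fun h =>
      hw (weight_eq_zero (by simp [positions, hx]) h)
  -- One linear equation between the two final probabilities for each admissible weight.
  have hmean : ∀ g : ℤ → NNReal, IsHarmonicOn q (c.MSet.map fun i : ℕ => (i : ℤ)) n g →
      (∀ x, g x ≠ 0 → 0 < x) →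
      (finalSupportProb q u T₁).toReal * ((∏ x ∈ T₁, g x : NNReal) : ℝ) +
        (finalSupportProb q u T₂).toReal * ((∏ x ∈ T₂, g x : NNReal) : ℝ) =
      ((c.MSet.map fun i : ℕ => g i).prod : NNReal) := by
    intro g hg hpos
    have h := sum_finalSupportProb_mul_weight (hv ▸ hg) hum _ (hmem g hpos)
    rw [Finset.sum_pair hne, hprod] at h
    have h' := congrArg ENNReal.toReal h
    have hfin : ∀ T, finalSupportProb q u T ≠ ⊤ := fun T =>
      ne_top_of_le_ne_top ENNReal.one_ne_top (finalSupportProb_le_one q u T)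
    rwa [ENNReal.toReal_add (ENNReal.mul_ne_top (hfin _) ENNReal.coe_ne_top)
      (ENNReal.mul_ne_top (hfin _) ENNReal.coe_ne_top), ENNReal.toReal_mul, ENNReal.toReal_mul,
      ENNReal.coe_toReal, ENNReal.coe_toReal, ENNReal.coe_toReal] at h'
  have h1 := hmean _ (isHarmonicOn_leftWeight q _ n) fun x => pos_of_leftWeight_ne_zero
  have h2 := hmean _ (hD.isHarmonicOn_splitWeight q n) fun x =>
    pos_of_splitWeight_ne_zero (by lia)
  rw [prod_splitWeight_eq_zero q hj1 hjn.le, prod_splitWeight q hj1 (by lia),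
    coe_prod_splitWeight q hjM, NNReal.coe_zero, mul_zero, zero_add] at h2
  rw [prod_leftWeight, coe_prod_leftWeight] at h1
  have h3 := qInt_mul_prod_leftWeight q hj1 (n := n) (by lia)
  have hfac : ∀ k, 0 < qFactorial q k := fun k =>
    Finset.prod_pos fun i hi => qInt_pos q (Finset.mem_Icc.1 hi).1
  have hjf : qFactorial q j = qFactorial q (j - 1) * qInt q j := by
    obtain ⟨i, rfl⟩ := Nat.exists_eq_add_of_le' hj1
    exact Finset.prod_Icc_succ_top (by lia) _
  -- Both initial products are replaced by their expressions in the two probabilities; the terms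
  -- with `T₂` then cancel.
  rw [remixedEulerian, ← h1, mul_assoc, ← h2, qBinom, ← h3, hjf]
  have := (hfac (j - 1)).ne'
  have := (hfac (n + 1 - j)).ne'
  have := (qInt_pos q hj1).ne'
  field_simp
  ring
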